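/- Write $\widehat{\mathbb{C}} = \mathbb{C}\cup\{\infty\}$. A transcendental meromorphic function is a function $f$ meromorphic in $\mathbb{C}$ (with values in $\widehat{\mathbb{C}}$, equal to $\infty$ at its poles) that has an essential singularity at $\infty$, that is, $f$ does not extend meromorphically to a neighbourhood of $\infty$; it is undefined at $\infty$. Functions $f$ and $g$ defined on subsets of $\widehat{\mathbb{C}}$ permute if, for every $z\in\widehat{\mathbb{C}}$, either $f(g(z)) = g(f(z))$, or both $f(g(z))$ and $g(f(z))$ are undefined. Theorem 1.1. Let $g\colon\widehat{\mathbb{C}}\to\widehat{\mathbb{C}}$ be a non-constant rational map. Then there exists a transcendental meromorphic function $f$ that permutes with $g$ if and only if $g$ is an affine map of the form $g(z) = z e^{2\pi i m/n} + c$ for some $m, n\in\mathbb{Z}$ with $n\neq 0$ and some $c\in\mathbb{C}$ (with $g(\infty)=\infty$). -/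

import Mathlib

open scoped OnePoint

noncomputable section

/-- The map of the Riemann sphere `ℂ ∪ {∞}` to itself defined by a rational function `r = p / q`
in lowest terms (`q` monic). At a finite point it is `∞` at the zeros of `q` and `p / q` elsewhere;
at `∞` it is the limit of `p / q` at infinity. -/
def ratMap (r : RatFunc ℂ) : OnePoint ℂ → OnePoint ℂ := fun w =>
  w.elim
    (if r.denom.natDegree < r.num.natDegree then ∞
      else ((r.num.coeff r.denom.natDegree / r.denom.leadingCoeff : ℂ) : OnePoint ℂ))
    (fun z => if r.denom.eval z = 0 then ∞
      else ((r.num.eval z / r.denom.eval z : ℂ) : OnePoint ℂ))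

/-- A rational map of the Riemann sphere. -/
def IsRationalMap (g : OnePoint ℂ → OnePoint ℂ) : Prop :=
  ∃ r : RatFunc ℂ, g = ratMap r

/-- The function with values in the Riemann sphere given by a function `φ` that is meromorphic in
`ℂ` and in normal form (analytic off its poles): it is `∞` at the poles of `φ`, it is `φ z`
at every other `z : ℂ`, and it is undefined at `∞`. -/
def merMap (φ : ℂ → ℂ) : OnePoint ℂ →. OnePoint ℂ := fun w =>
  w.elim Part.none
    (fun z => Part.some (if meromorphicOrderAt φ z < 0 then ∞ else ((φ z : ℂ) : OnePoint ℂ)))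

/-- A transcendental meromorphic function: meromorphic in `ℂ`, with an essential singularity at
`∞` (it has no meromorphic extension to a neighbourhood of `∞`; poles may accumulate there).
It is regarded as a partial function on the Riemann sphere with domain `ℂ`. -/
def IsTranscendentalMeromorphic (f : OnePoint ℂ →. OnePoint ℂ) : Prop :=
  ∃ φ : ℂ → ℂ, MeromorphicNFOn φ Set.univ ∧
    ¬ MeromorphicAt (fun w : ℂ => φ w⁻¹) 0 ∧ f = merMap φ

/-- Two partial functions on the Riemann sphere permute: at every point, `f ∘ g` and `g ∘ f` are
either both undefined, or both defined and equal. A composition is defined at `w` if the inner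
function is defined at `w` and the outer one is defined at its value. -/
def Permutes (f g : OnePoint ℂ →. OnePoint ℂ) : Prop :=
  f.comp g = g.comp f

end

open Filter Topology Polynomial

/-! ### Reduction to a polynomial `g`. -/

section Permutation

variable {φ : ℂ → ℂ} {r : RatFunc ℂ}

/-! Since `f` is undefined exactly at `∞`, permuting forces `g ∞ = ∞` and leaves `g` without finite
poles. So `g` is a polynomial `q`, the pole set of `f` is completely invariant under `q`, and `f ∘ q
= q ∘ f` off the poles.

Let `deg q ≥ 2`. If `f` has a pole, `Polynomial.exists_eq_of_preimage_eq` gives `q z = x + a (z - x)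
^ d` with `x` the only pole. Near this superattracting point the functional equation makes `f` a
monomial in `z - x`, up to adding `x`, so `f` is rational. If `f` is entire, pulling discs back
under `q` bounds `f` polynomially on a sequence of discs, and `f` is a polynomial. Neither is
transcendental.

Let `q z = a z + b` with `a` not a root of unity. Centred at the fixed point of `q`, the equation
reads `F (a w) = a F w`; comparing Laurent expansions leaves only a linear term.

Conversely, explicit entire functions commute with `z ↦ a z + c` whenever `a ^ N = 1`: a translation
plus periodic exponential, or a rotation-equivariant map about a fixed point. -/

theorem merMap_infty : merMap φ ∞ = Part.none := rfl

theorem merMap_coe (z : ℂ) : merMap φ (z : OnePoint ℂ) =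
    Part.some (if meromorphicOrderAt φ z < 0 then ∞ else ((φ z : ℂ) : OnePoint ℂ)) := rfl

theorem permutes_apply {f : OnePoint ℂ →. OnePoint ℂ} {g : OnePoint ℂ → OnePoint ℂ}
    (h : Permutes f (g : OnePoint ℂ →. OnePoint ℂ)) (w : OnePoint ℂ) :
    f (g w) = (f w).map g := by
  have := congrFun h w
  rw [PFun.comp_apply, PFun.comp_apply, PFun.coe_val] at this
  exact (Part.bind_some (g w) f).symm.trans (this.trans (Part.bind_some_eq_map g (f w)))

theorem ratMap_infty_eq_infty_of_permutes
    (h : Permutes (merMap φ) (ratMap r : OnePoint ℂ →. OnePoint ℂ)) : ratMap r ∞ = ∞ := by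
  have h1 := permutes_apply h ∞
  rw [merMap_infty, Part.map_none] at h1
  induction hw : ratMap r ∞ using OnePoint.rec with
  | infty => rfl
  | coe z => rw [hw, merMap_coe] at h1; exact absurd h1 (Part.some_ne_none _)

theorem denom_eval_ne_zero_of_permutes
    (h : Permutes (merMap φ) (ratMap r : OnePoint ℂ →. OnePoint ℂ)) (z : ℂ) :
    r.denom.eval z ≠ 0 := by
  intro h0
  have h1 := permutes_apply h z
  have h2 : ratMap r (z : OnePoint ℂ) = ∞ := by simp [ratMap, h0]
  rw [h2, merMap_infty, merMap_coe, Part.map_some] at h1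
  exact Part.some_ne_none _ h1.symm

theorem denom_eq_one_of_permutes
    (h : Permutes (merMap φ) (ratMap r : OnePoint ℂ →. OnePoint ℂ)) : r.denom = 1 := by
  by_contra hne
  obtain ⟨z, hz⟩ := IsAlgClosed.exists_root r.denom
    (fun hd => hne ((r.monic_denom).degree_le_zero_iff_eq_one.1 hd.le))
  exact denom_eval_ne_zero_of_permutes h z hz

theorem ratMap_coe_of_denom_eq_one (h : r.denom = 1) (z : ℂ) :
    ratMap r (z : OnePoint ℂ) = ((r.num.eval z : ℂ) : OnePoint ℂ) := by
  simp [ratMap, h]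

theorem natDegree_pos_of_permutes
    (h : Permutes (merMap φ) (ratMap r : OnePoint ℂ →. OnePoint ℂ)) : 0 < r.num.natDegree := by
  have h1 := ratMap_infty_eq_infty_of_permutes h
  by_contra h2
  simp [ratMap, denom_eq_one_of_permutes h, h2] at h1

/-- The functional equation of a meromorphic function (in normal form) that commutes with a
polynomial. -/
def CommutesWithPoly (φ : ℂ → ℂ) (q : ℂ[X]) : Prop :=
  ∀ z, (meromorphicOrderAt φ (q.eval z) < 0 ↔ meromorphicOrderAt φ z < 0) ∧
    (¬ meromorphicOrderAt φ z < 0 → φ (q.eval z) = q.eval (φ z))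

theorem commutesWithPoly_of_permutes
    (h : Permutes (merMap φ) (ratMap r : OnePoint ℂ →. OnePoint ℂ)) :
    CommutesWithPoly φ r.num := by
  intro z
  have h1 := permutes_apply h z
  have hd := denom_eq_one_of_permutes h
  rw [ratMap_coe_of_denom_eq_one hd, merMap_coe, merMap_coe, Part.map_some, Part.some_inj] at h1
  by_cases hz : meromorphicOrderAt φ z < 0 <;>
    by_cases hq : meromorphicOrderAt φ (r.num.eval z) < 0
  · simp [hz, hq]
  · simp [hz, hq, ratMap_infty_eq_infty_of_permutes h] at h1
  · simp [hz, hq, ratMap_coe_of_denom_eq_one hd] at h1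
  · simp only [hz, hq, if_false, ratMap_coe_of_denom_eq_one hd, OnePoint.coe_eq_coe] at h1
    exact ⟨by simp [hz, hq], fun _ => h1⟩

end Permutation

/-! ### Identity theorem: local agreement decides the behaviour at infinity. -/

section Identity

theorem MeromorphicNFOn.meromorphicAt_comp_inv_of_eventuallyEq {φ R : ℂ → ℂ} {x : ℂ}
    (hφ : MeromorphicNFOn φ Set.univ) (hR : MeromorphicOn R Set.univ)
    (hRa : ∀ᶠ z in Bornology.cobounded ℂ, AnalyticAt ℂ R z)
    (hRi : MeromorphicAt (fun w => R w⁻¹) 0) (h : φ =ᶠ[𝓝[≠] x] R) :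
    MeromorphicAt (fun w => φ w⁻¹) 0 := by
  have hD : MeromorphicOn (φ - R) Set.univ := hφ.meromorphicOn.sub hR
  have htop : ∀ y, meromorphicOrderAt (φ - R) y = ⊤ := by
    intro y
    by_contra hy
    refine hD.meromorphicOrderAt_ne_top_of_isPreconnected (x := y) (y := x) isPreconnected_univ
      (Set.mem_univ _) (Set.mem_univ _) hy (meromorphicOrderAt_eq_top_iff.2 ?_)
    filter_upwards [h] with z hz
    simp [hz]
  have heq : ∀ y, AnalyticAt ℂ R y → φ y = R y := by
    intro y hy
    have h1 : φ =ᶠ[𝓝[≠] y] R := by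
      filter_upwards [meromorphicOrderAt_eq_top_iff.1 (htop y)] with z hz
      simpa [sub_eq_zero] using hz
    -- Normal form upgrades agreement near `y` to agreement at `y`.
    have h2 := ((hφ (Set.mem_univ y)).eventuallyEq_nhdsNE_iff_eventuallyEq_nhds
      hy.meromorphicNFAt).1 h1
    exact h2.eq_of_nhds
  refine hRi.congr ?_
  have := (tendsto_inv₀_nhdsNE_zero (α := ℂ)).eventually hRa
  filter_upwards [this] with w hw
  exact (heq _ hw).symm

end Identity

/-! ### Rigidity at a superattracting fixed point. -/

section LocalRigidity

/-- Differentiating gives `h' (q z) * q' z = b d h ^ (d - 1) * h' z`, whose factor before `h'` is a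
unit at `x`. Thus `ord h' * ord (q - x) + ord q' = ord h'`; as `ord (q - x)` and `ord q'` are at
least 1, `ord h'` must be infinite. -/
theorem AnalyticAt.eventually_eq_of_comp_eq_mul_pow {h q : ℂ → ℂ} {x b : ℂ} {d : ℕ}
    (hh : AnalyticAt ℂ h x) (hx : h x ≠ 0) (hq : AnalyticAt ℂ q x) (hqx : q x = x)
    (hq' : deriv q x = 0) (hb : b ≠ 0) (hd : d ≠ 0)
    (heq : ∀ᶠ z in 𝓝 x, h (q z) = b * h z ^ d) : ∀ᶠ z in 𝓝 x, h z = h x := by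
  have hh' := hh.deriv
  have hhq : AnalyticAt ℂ (deriv h) (q x) := by rwa [hqx]
  have hder : (deriv h ∘ q) * deriv q =ᶠ[𝓝 x] (fun z => b * (d * h z ^ (d - 1))) * deriv h := by
    have hev : ∀ᶠ z in 𝓝 x, AnalyticAt ℂ h (q z) := by
      have hc := hq.continuousAt.tendsto
      rw [hqx] at hc
      exact hc.eventually hh.eventually_analyticAt
    filter_upwards [heq.eventually_nhds, hh.eventually_analyticAt, hq.eventually_analyticAt, hev]
      with z h1 h2 h3 h4
    have e1 : HasDerivAt (fun z => h (q z)) (deriv h (q z) * deriv q z) z :=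
      h4.differentiableAt.hasDerivAt.comp z h3.differentiableAt.hasDerivAt
    have e2 : HasDerivAt (fun z => b * h z ^ d) (b * (d * h z ^ (d - 1) * deriv h z)) z :=
      (h2.differentiableAt.hasDerivAt.pow d).const_mul b
    have := (e1.congr_of_eventuallyEq (EventuallyEq.symm h1)).unique e2
    simp only [Pi.mul_apply, Function.comp_apply, this]
    ring
  have hord := analyticOrderAt_congr hder
  have hu : AnalyticAt ℂ (fun z => b * (d * h z ^ (d - 1))) x := by fun_prop
  rw [analyticOrderAt_mul (hhq.comp hq) hq.deriv, analyticOrderAt_mul hu hh',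
    hu.analyticOrderAt_eq_zero.2 (by simp [hb, hd, hx]), zero_add,
    hhq.analyticOrderAt_comp hq, hqx] at hord
  have h1 : 1 ≤ analyticOrderAt (deriv q) x :=
    Order.one_le_iff_ne_zero.2 (hq.deriv.analyticOrderAt_ne_zero.2 hq')
  have h2 : 1 ≤ analyticOrderAt (fun z => q z - x) x :=
    Order.one_le_iff_ne_zero.2 ((hq.sub analyticAt_const).analyticOrderAt_ne_zero.2 (by simp [hqx]))
  have htop : analyticOrderAt (deriv h) x = ⊤ := by
    by_contra hne
    have h3 : analyticOrderAt (deriv h) x + 1 ≤ analyticOrderAt (deriv h) x := by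
      conv_rhs => rw [← hord]
      exact add_le_add (le_mul_of_one_le_right zero_le h2) h1
    exact absurd (ENat.add_one_le_iff hne |>.1 h3) (lt_irrefl _)
  rw [analyticOrderAt_eq_top] at htop
  obtain ⟨ε, hε, hball⟩ := Metric.eventually_nhds_iff_ball.1 (htop.and hh.eventually_analyticAt)
  filter_upwards [Metric.ball_mem_nhds x hε] with z hz
  exact (convex_ball x ε).is_const_of_fderivWithin_eq_zero (𝕜 := ℂ) (f := h)
    (fun y hy => (hball y hy).2.differentiableAt.differentiableWithinAt)
    (fun y hy => by
      rw [fderivWithin_of_isOpen Metric.isOpen_ball hy]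
      ext
      simpa using (hball y hy).1) hz (Metric.mem_ball_self hε)

end LocalRigidity

/-! ### Growth and surjectivity of polynomials. -/

section PolynomialGrowth

open Bornology Asymptotics

theorem Polynomial.exists_norm_eval_le (q : ℂ[X]) :
    ∃ C : ℝ, 1 ≤ C ∧ ∀ (M : ℝ) (z : ℂ), 1 ≤ M → ‖z‖ ≤ M → ‖q.eval z‖ ≤ C * M ^ q.natDegree := by
  refine ⟨1 + ∑ i ∈ Finset.range (q.natDegree + 1), ‖q.coeff i‖,
    le_add_of_nonneg_right (by positivity), fun M z hM hz => ?_⟩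
  rw [eval_eq_sum_range]
  calc ‖∑ i ∈ Finset.range (q.natDegree + 1), q.coeff i * z ^ i‖
      ≤ ∑ i ∈ Finset.range (q.natDegree + 1), ‖q.coeff i‖ * M ^ q.natDegree := by
        refine norm_sum_le_of_le _ fun i hi => ?_
        rw [norm_mul, norm_pow]
        gcongr
        exact (pow_le_pow_left₀ (norm_nonneg _) hz i).trans
          (pow_le_pow_right₀ hM (Finset.mem_range_succ_iff.1 hi))
    _ = (∑ i ∈ Finset.range (q.natDegree + 1), ‖q.coeff i‖) * M ^ q.natDegree := by
        rw [Finset.sum_mul]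
    _ ≤ _ := by gcongr; linarith

theorem Polynomial.exists_le_norm_eval {q : ℂ[X]} (hq : q ≠ 0) :
    ∃ c R : ℝ, 0 < c ∧ c ≤ 1 ∧ 1 ≤ R ∧ ∀ z : ℂ, R ≤ ‖z‖ → c * ‖z‖ ^ q.natDegree ≤ ‖q.eval z‖ := by
  have h1 := (isEquivalent_cobounded_leading_monomial (P := q)).symm.isBigO
  obtain ⟨C, hC, hO⟩ := h1.exists_pos
  have hev := hO.bound
  rw [← comap_norm_atTop, eventually_comap, eventually_atTop] at hev
  obtain ⟨R, hR⟩ := hev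
  have hl : 0 < ‖q.leadingCoeff‖ := norm_pos_iff.2 (leadingCoeff_ne_zero.2 hq)
  refine ⟨min 1 (‖q.leadingCoeff‖ / C), max 1 R, by positivity, min_le_left _ _, le_max_left _ _,
    fun z hz => ?_⟩
  have h2 := hR ‖z‖ ((le_max_right _ _).trans hz) z rfl
  rw [norm_mul, norm_pow] at h2
  calc min 1 (‖q.leadingCoeff‖ / C) * ‖z‖ ^ q.natDegree
      ≤ (‖q.leadingCoeff‖ / C) * ‖z‖ ^ q.natDegree := by gcongr; exact min_le_right _ _
    _ = (‖q.leadingCoeff‖ * ‖z‖ ^ q.natDegree) / C := by ring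
    _ ≤ ‖q.eval z‖ := by rw [div_le_iff₀ hC]; linarith

theorem Polynomial.surjective_eval {q : ℂ[X]} (hq : 0 < q.natDegree) (w : ℂ) :
    ∃ z, q.eval z = w := by
  obtain ⟨z, hz⟩ := IsAlgClosed.exists_root (q - C w) (by
    rw [degree_sub_C (natDegree_pos_iff_degree_pos.1 hq)]
    exact (natDegree_pos_iff_degree_pos.1 hq).ne')
  exact ⟨z, by simpa [sub_eq_zero] using hz⟩

end PolynomialGrowth

/-! ### Entire functions commuting with a polynomial of degree at least two. -/

section Entire

/-- Cauchy's estimates on the circles of radius `ρ n` kill every Taylor coefficient beyond `N`. -/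
theorem eq_sum_of_norm_le_pow {f : ℂ → ℂ} (hf : Differentiable ℂ f) {ρ : ℕ → ℝ} {N : ℕ}
    (hρ : Tendsto ρ atTop atTop) (h : ∀ n z, ‖z‖ ≤ ρ n → ‖f z‖ ≤ ρ n ^ N) (z : ℂ) :
    f z = ∑ k ∈ Finset.range (N + 1), (k.factorial : ℂ)⁻¹ * iteratedDeriv k f 0 * z ^ k := by
  have hzero : ∀ k, N < k → iteratedDeriv k f 0 = 0 := by
    intro k hk
    have hle : ∀ᶠ n in atTop, ‖iteratedDeriv k f 0‖ ≤ k.factorial * (ρ n)⁻¹ := by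
      filter_upwards [hρ.eventually_ge_atTop 1] with n hn
      have h0 : 0 < ρ n := by linarith
      refine (Complex.norm_iteratedDeriv_le_of_forall_mem_sphere_norm_le k h0 hf.diffContOnCl
        (fun z hz => h n z (mem_sphere_zero_iff_norm.1 hz).le)).trans ?_
      rw [mul_div_assoc]
      gcongr
      rw [div_le_iff₀ (by positivity), inv_mul_eq_div, le_div_iff₀ h0, ← pow_succ]
      exact pow_le_pow_right₀ hn hk
    have hlim : Tendsto (fun n => (k.factorial : ℝ) * (ρ n)⁻¹) atTop (𝓝 0) := by
      simpa using (tendsto_inv_atTop_zero.comp hρ).const_mul (k.factorial : ℝ)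
    exact norm_le_zero_iff.1 (ge_of_tendsto hlim hle)
  have hs := Complex.hasSum_taylorSeries_of_entire hf 0 z
  have hs' : HasSum (fun k : ℕ => (k.factorial : ℂ)⁻¹ • (z - 0) ^ k • iteratedDeriv k f 0)
      (∑ k ∈ Finset.range (N + 1), (k.factorial : ℂ)⁻¹ • (z - 0) ^ k • iteratedDeriv k f 0) := by
    refine hasSum_sum_of_ne_finset_zero fun k hk => ?_
    rw [hzero k (by simpa using hk)]
    simp
  rw [hs.unique hs']
  refine Finset.sum_congr rfl fun k _ => ?_
  simp only [smul_eq_mul, sub_zero]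
  ring

/-- Every `w` is some `q z` with `‖z‖` about `‖w‖ ^ (1 / d)`, and `φ w = q (φ z)`. So raising the
radius to the power `d` raises the bound on `φ` to the power `d` as well, and their logarithms stay
comparable. -/
theorem Differentiable.exists_norm_le_pow_of_commutes {φ : ℂ → ℂ} {q : ℂ[X]}
    (hφ : Differentiable ℂ φ) (hq : 2 ≤ q.natDegree)
    (h : ∀ z, φ (q.eval z) = q.eval (φ z)) :
    ∃ (ρ : ℕ → ℝ) (N : ℕ), Tendsto ρ atTop atTop ∧ ∀ n z, ‖z‖ ≤ ρ n → ‖φ z‖ ≤ ρ n ^ N := by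
  obtain ⟨C, hC, hup⟩ := q.exists_norm_eval_le
  obtain ⟨c, R, hc, hc1, hR, hlow⟩ := exists_le_norm_eval (q := q) (by rintro rfl; simp at hq)
  set d := q.natDegree with hd
  -- The term `c * R` puts points outside the disc of radius `ρ₀ / c` in the range of the lower
  -- bound for `q`.
  set ρ₀ : ℝ := max 2 (c * R) with hρ₀
  have hρ2 : 2 ≤ ρ₀ := le_max_left _ _
  obtain ⟨M, hM⟩ := (isCompact_closedBall (0 : ℂ) (ρ₀ / c)).exists_bound_of_continuousOn
    hφ.continuous.continuousOn
  set μ₀ : ℝ := C * max 1 M with hμ₀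
  have hd1 : d ≠ 0 := by omega
  -- The factors `1 / c` and `C` absorb the constants of the two growth bounds, so the recursion is
  -- between pure powers; this uses `d ≥ 2`.
  have key : ∀ n z, ‖z‖ ≤ ρ₀ ^ d ^ n / c → C * ‖φ z‖ ≤ μ₀ ^ d ^ n := by
    intro n
    have hμ1 : 1 ≤ μ₀ := one_le_mul_of_one_le_of_one_le hC (le_max_left _ _)
    have hρ1 : ρ₀ ≤ ρ₀ ^ d ^ n := le_self_pow₀ (by linarith) (pow_ne_zero _ hd1)
    induction n with
    | zero =>
      intro z hz
      rw [pow_zero, pow_one] at hz ⊢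
      have := hM z (by simpa using hz)
      rw [hμ₀]
      gcongr
      exact this.trans (le_max_right _ _)
    | succ n ih =>
      intro w hw
      have hρn : ρ₀ ≤ ρ₀ ^ d ^ n := le_self_pow₀ (by linarith) (pow_ne_zero _ hd1)
      obtain ⟨z, rfl⟩ := surjective_eval (q := q) (by omega) w
      have hz : ‖z‖ ≤ ρ₀ ^ d ^ n / c := by
        by_contra! hlt
        have hRz : R ≤ ‖z‖ := by
          refine le_trans ?_ hlt.le
          rw [le_div_iff₀ hc]
          linarith [le_max_right 2 (c * R)]
        have h1 := (hlow z hRz).trans hw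
        have h2 : (ρ₀ ^ d ^ n / c) ^ d < ‖z‖ ^ d :=
          pow_lt_pow_left₀ hlt (by positivity) hd1
        rw [le_div_iff₀ hc] at h1
        have h3 : c ^ d ≤ c * c := by
          rw [← pow_two]; exact pow_le_pow_of_le_one hc.le hc1 hq
        rw [div_pow, div_lt_iff₀ (by positivity), ← pow_mul, ← pow_succ] at h2
        have h4 : ‖z‖ ^ d * c ^ d ≤ ‖z‖ ^ d * (c * c) := by gcongr
        linarith
      rw [h]
      have h5 := ih hρn z hz
      have h6 : ‖φ z‖ ≤ μ₀ ^ d ^ n / C := by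
        rw [le_div_iff₀ (by linarith)]; linarith
      have h7 : 1 ≤ μ₀ ^ d ^ n / C := by
        rw [le_div_iff₀ (by linarith), one_mul]
        calc C ≤ μ₀ := le_mul_of_one_le_right (by linarith) (le_max_left _ _)
          _ ≤ _ := le_self_pow₀ hμ1 (pow_ne_zero _ hd1)
      have h8 := hup _ _ h7 h6
      calc C * ‖q.eval (φ z)‖ ≤ C * (C * (μ₀ ^ d ^ n / C) ^ d) := by gcongr
        _ = C ^ 2 / C ^ d * μ₀ ^ d ^ (n + 1) := by
          rw [div_pow, ← pow_mul, ← pow_succ]; ring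
        _ ≤ 1 * μ₀ ^ d ^ (n + 1) := by
          gcongr
          rw [div_le_one (by positivity)]
          exact pow_le_pow_right₀ hC hq
        _ = _ := one_mul _
  obtain ⟨N, hN⟩ := pow_unbounded_of_one_lt μ₀ (show 1 < ρ₀ by linarith)
  refine ⟨fun n => ρ₀ ^ d ^ n, N, ?_, fun n z hz => ?_⟩
  · exact (tendsto_pow_atTop_atTop_of_one_lt (by linarith)).comp
      (tendsto_pow_atTop_atTop_of_one_lt (by omega))
  · have h1 := key n z (hz.trans (le_div_self (by positivity) hc hc1))
    calc ‖φ z‖ ≤ C * ‖φ z‖ := le_mul_of_one_le_left (norm_nonneg _) hC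
      _ ≤ μ₀ ^ d ^ n := h1
      _ ≤ (ρ₀ ^ N) ^ d ^ n := pow_le_pow_left₀ (by positivity) hN.le _
      _ = (ρ₀ ^ d ^ n) ^ N := by rw [← pow_mul, ← pow_mul, mul_comm]

theorem meromorphicAt_comp_inv_of_commutes_of_entire {φ : ℂ → ℂ} {q : ℂ[X]}
    (hφ : Differentiable ℂ φ) (hq : 2 ≤ q.natDegree)
    (h : ∀ z, φ (q.eval z) = q.eval (φ z)) : MeromorphicAt (fun w => φ w⁻¹) 0 := by
  obtain ⟨ρ, N, hρ, hle⟩ := hφ.exists_norm_le_pow_of_commutes hq h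
  simp_rw [eq_sum_of_norm_le_pow hφ hρ hle]
  refine MeromorphicAt.fun_sum fun k _ => ?_
  exact (MeromorphicAt.const _ (0 : ℂ)).mul ((MeromorphicAt.id (0 : ℂ)).inv.pow k)

end Entire

/-! ### Completely invariant pole sets. -/

section Poles

/-- A nonempty locally finite set that is completely invariant under a polynomial of degree at
least two is a single totally ramified fixed point. -/
theorem Polynomial.exists_eq_of_preimage_eq {q : ℂ[X]} (hq : 2 ≤ q.natDegree) {P : Set ℂ}
    (hfin : ∀ R, (P ∩ Metric.closedBall 0 R).Finite) (hinv : ∀ z, q.eval z ∈ P ↔ z ∈ P)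
    {x : ℂ} (hx : x ∈ P) :
    P = {x} ∧ ∃ a : ℂ, a ≠ 0 ∧ ∀ z, q.eval z = x + a * (z - x) ^ q.natDegree := by
  have hq0 : q ≠ 0 := by rintro rfl; simp at hq
  obtain ⟨c, R, hc, hc1, hR, hlow⟩ := exists_le_norm_eval hq0
  -- In a large disc the finite set `F` contains all preimages of its points. A choice of preimages
  -- is an injection `F → F`, hence onto, so no point of `F` has a second preimage.
  have huniq : ∀ y ∈ P, ∃ s, ∀ z, q.eval z = y ↔ z = s := by
    intro y hy
    obtain ⟨S, hSR, hSc, hSy⟩ : ∃ S, R ≤ S ∧ 1 / c ≤ S ∧ ‖y‖ ≤ S :=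
      ⟨max R (max (1 / c) ‖y‖), by simp, by simp, by simp⟩
    set F := P ∩ Metric.closedBall 0 S
    have hback : ∀ z, q.eval z ∈ F → z ∈ F := by
      rintro z ⟨h1, h2⟩
      refine ⟨(hinv z).1 h1, ?_⟩
      rw [mem_closedBall_zero_iff] at h2 ⊢
      by_contra! hlt
      have h3 := (hlow z (hSR.trans hlt.le)).trans h2
      have h4 : ‖z‖ ^ 2 ≤ ‖z‖ ^ q.natDegree := pow_le_pow_right₀ (by linarith) hq
      have h5 : 1 ≤ c * ‖z‖ := by
        rw [div_le_iff₀ hc] at hSc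
        nlinarith
      nlinarith [mul_le_mul_of_nonneg_left h4 hc.le]
    have hF : Finite F := hfin S
    choose s hs using fun w => surjective_eval (q := q) (by omega) w
    let t : F → F := fun y => ⟨s y, hback _ (by rw [hs]; exact y.2)⟩
    have ht : Function.Injective t := fun u v huv => by
      have h1 : s u = s v := congrArg Subtype.val huv
      apply Subtype.ext
      rw [← hs u, ← hs v, h1]
    have hyF : y ∈ F := ⟨hy, by simpa using hSy⟩
    refine ⟨s y, fun z => ⟨fun hz => ?_, fun hz => hz ▸ hs y⟩⟩
    obtain ⟨u, hu⟩ := (Finite.injective_iff_surjective.1 ht) ⟨z, hback z (by rwa [hz])⟩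
    have h1 : s u = z := congrArg Subtype.val hu
    rw [← h1, hs] at hz
    rw [← h1, hz]
  have hform : ∀ y ∈ P, ∃ s, q.eval s = y ∧
      q = C y + C q.leadingCoeff * (X - C s) ^ q.natDegree := by
    intro y hy
    obtain ⟨s, hs⟩ := huniq y hy
    refine ⟨s, (hs s).2 rfl, ?_⟩
    have hdeg : 0 < q.degree := natDegree_pos_iff_degree_pos.1 (by omega)
    have hsp := IsAlgClosed.splits (q - C y)
    have hne : q - C y ≠ 0 := by
      intro h0; rw [sub_eq_zero.1 h0] at hdeg; exact absurd hdeg (not_lt.2 degree_C_le)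
    have hroots : (q - C y).roots = Multiset.replicate q.natDegree s := by
      rw [Multiset.eq_replicate]
      refine ⟨by rw [← hsp.natDegree_eq_card_roots, natDegree_sub_C], fun z hz => ?_⟩
      rw [mem_roots hne] at hz
      exact (hs z).1 (by simpa [sub_eq_zero] using hz)
    have := hsp.eq_prod_roots
    rw [hroots, Multiset.map_replicate, Multiset.prod_replicate, leadingCoeff_sub_of_degree_lt
      (lt_of_le_of_lt degree_C_le hdeg)] at this
    rw [← this]; ring
  have hlc : q.leadingCoeff ≠ 0 := leadingCoeff_ne_zero.2 hq0
  have hcrit : ∀ s y, q = C y + C q.leadingCoeff * (X - C s) ^ q.natDegree →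
      ∀ z, q.derivative.eval z = 0 ↔ z = s := by
    intro s y hqs z
    have hne : q.natDegree ≠ 0 := by omega
    have hne' : q.natDegree - 1 ≠ 0 := by omega
    have h1 : q.derivative.eval z = q.leadingCoeff * (q.natDegree * (z - s) ^ (q.natDegree - 1)) := by
      conv_lhs => rw [hqs]
      simp [derivative_X_sub_C_pow]
    rw [h1]
    simp [hlc, hne, hne', sub_eq_zero]
  -- Each point of `P` is the image of the unique critical point of `q`.
  have hsub : ∀ y ∈ P, y = x := by
    intro y hy
    obtain ⟨s, hs, h1⟩ := hform y hy
    obtain ⟨t, ht, h2⟩ := hform x hx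
    have : s = t := (hcrit t x h2 s).1 ((hcrit s y h1 s).2 rfl)
    rw [← hs, ← ht, this]
  refine ⟨Set.eq_singleton_iff_unique_mem.2 ⟨hx, hsub⟩, q.leadingCoeff, hlc, fun z => ?_⟩
  obtain ⟨t, ht, h2⟩ := hform x hx
  have : t = x := hsub t ((hinv t).1 (by rwa [ht]))
  conv_lhs => rw [h2]
  simp [this]

end Poles

/-! ### Degree at least two: no transcendental solution. -/

section HighDegree

variable {φ : ℂ → ℂ} {q : ℂ[X]}

theorem MeromorphicNFOn.analyticAt_of_not_neg (hφ : MeromorphicNFOn φ Set.univ) {z : ℂ}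
    (hz : ¬ meromorphicOrderAt φ z < 0) : AnalyticAt ℂ φ z :=
  (hφ (Set.mem_univ z)).meromorphicOrderAt_nonneg_iff_analyticAt.1 (not_lt.1 hz)

theorem MeromorphicAt.eventually_not_meromorphicOrderAt_neg {x : ℂ} (hφ : MeromorphicAt φ x) :
    ∀ᶠ z in 𝓝[≠] x, ¬ meromorphicOrderAt φ z < 0 :=
  hφ.eventually_analyticAt.mono fun _ hz => not_lt.2 hz.meromorphicOrderAt_nonneg

theorem MeromorphicNFOn.finite_poles_inter_closedBall (hφ : MeromorphicNFOn φ Set.univ) (R : ℝ) :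
    ({z | meromorphicOrderAt φ z < 0} ∩ Metric.closedBall 0 R).Finite := by
  have h1 := (hφ.meromorphicOn.mono_set (Set.subset_univ
    (Metric.closedBall (0 : ℂ) R))).analyticAt_mem_codiscreteWithin
  refine ((isCompact_closedBall (0 : ℂ) R).finite_sdiff_of_mem_codiscreteWithin h1).subset ?_
  rintro z ⟨hz, hzR⟩
  exact ⟨hzR, fun h => absurd hz (not_lt.2 (AnalyticAt.meromorphicOrderAt_nonneg h))⟩

/-- Writing `φ - x = (z - x) ^ n * u` with `u x ≠ 0`, the functional equation becomes `u ∘ q = a ^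
(1 - n) * u ^ d`, and local rigidity makes `u` constant. -/
theorem CommutesWithPoly.exists_eventuallyEq_zpow {x a : ℂ} {d : ℕ} (hφ : MeromorphicAt φ x)
    (h : CommutesWithPoly φ q) (ha : a ≠ 0) (hd : 2 ≤ d)
    (hq : ∀ z, q.eval z = x + a * (z - x) ^ d) :
    ∃ (c : ℂ) (n : ℤ), φ =ᶠ[𝓝[≠] x] fun z => x + c * (z - x) ^ n := by
  have hd0 : d ≠ 0 := by omega
  have hψ : MeromorphicAt (fun z => φ z - x) x := hφ.sub (MeromorphicAt.const _ _)
  by_cases htop : meromorphicOrderAt (fun z => φ z - x) x = ⊤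
  · refine ⟨0, 0, ?_⟩
    filter_upwards [meromorphicOrderAt_eq_top_iff.1 htop] with z hz
    simpa [sub_eq_zero] using hz
  obtain ⟨n, hn⟩ := WithTop.ne_top_iff_exists.1 htop
  obtain ⟨u, hu, hux, hev⟩ := (meromorphicOrderAt_eq_int_iff hψ).1 hn.symm
  have hqa : AnalyticAt ℂ (fun z => q.eval z) x := by
    simp_rw [hq]; fun_prop
  have hqx : q.eval x = x := by simp [hq, hd0]
  have hq' : deriv (fun z => q.eval z) x = 0 := by
    have : HasDerivAt (fun z : ℂ => x + a * (z - x) ^ d) (a * (d * (x - x) ^ (d - 1) * 1)) x :=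
      ((((hasDerivAt_id x).sub_const x).pow d).const_mul a).const_add x
    simp_rw [hq]
    rw [this.deriv]
    simp [show d - 1 ≠ 0 by omega]
  have htend : Tendsto (fun z => q.eval z) (𝓝[≠] x) (𝓝[≠] x) := by
    refine tendsto_nhdsWithin_iff.2 ⟨?_, ?_⟩
    · have := hqa.continuousAt.tendsto
      rw [hqx] at this
      exact this.mono_left nhdsWithin_le_nhds
    · filter_upwards [self_mem_nhdsWithin] with z hz
      have hz' : z - x ≠ 0 := sub_ne_zero.2 hz
      simp [hq, ha, hz']
  have hpunct : ∀ᶠ z in 𝓝[≠] x, u (q.eval z) = a ^ (1 - n) * u z ^ d := by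
    filter_upwards [hev, htend.eventually hev, hφ.eventually_not_meromorphicOrderAt_neg,
      self_mem_nhdsWithin] with z h1 h2 h3 hz
    have hz' : z - x ≠ 0 := sub_ne_zero.2 hz
    rw [(h z).2 h3, hq (φ z), hq z, add_sub_cancel_left, add_sub_cancel_left, h1, smul_eq_mul,
      smul_eq_mul, mul_pow, mul_zpow] at h2
    have hcomm : ((z - x) ^ d) ^ n = ((z - x) ^ n) ^ d := by
      rw [← zpow_natCast, ← zpow_natCast, ← zpow_mul, ← zpow_mul, mul_comm]
    rw [hcomm] at h2
    have hne : ((z - x) ^ n) ^ d ≠ 0 := pow_ne_zero _ (zpow_ne_zero _ hz')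
    have han : a ^ n ≠ 0 := zpow_ne_zero _ ha
    rw [zpow_sub₀ ha, zpow_one, hq z]
    field_simp
    refine mul_left_cancel₀ hne ?_
    linear_combination -h2
  have hnhds : ∀ᶠ z in 𝓝 x, u (q.eval z) = a ^ (1 - n) * u z ^ d := by
    have hu' : AnalyticAt ℂ u (q.eval x) := by rwa [hqx]
    exact (AnalyticAt.frequently_eq_iff_eventually_eq
      (AnalyticAt.comp (f := fun z => q.eval z) hu' hqa)
      (analyticAt_const.mul (hu.pow d))).1 hpunct.frequently
  have hconst := hu.eventually_eq_of_comp_eq_mul_pow hux hqa hqx hq' (zpow_ne_zero _ ha) hd0 hnhds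
  refine ⟨u x, n, ?_⟩
  filter_upwards [hev, hconst.filter_mono nhdsWithin_le_nhds] with z h1 h2
  rw [h2, smul_eq_mul] at h1
  linear_combination h1

theorem CommutesWithPoly.meromorphicAt_comp_inv (hφ : MeromorphicNFOn φ Set.univ)
    (h : CommutesWithPoly φ q) (hq : 2 ≤ q.natDegree) : MeromorphicAt (fun w => φ w⁻¹) 0 := by
  by_cases hP : ∃ x, meromorphicOrderAt φ x < 0
  · obtain ⟨x, hx⟩ := hP
    obtain ⟨-, a, ha, hqa⟩ := exists_eq_of_preimage_eq hq hφ.finite_poles_inter_closedBall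
      (fun z => (h z).1) hx
    obtain ⟨c, n, hc⟩ := h.exists_eventuallyEq_zpow (hφ.meromorphicOn x (Set.mem_univ x)) ha hq hqa
    refine hφ.meromorphicAt_comp_inv_of_eventuallyEq (R := fun z => x + c * (z - x) ^ n)
      (fun z _ => by fun_prop) ?_ ?_ hc
    · have hne : ∀ᶠ z in Bornology.cobounded ℂ, z ≠ x := Bornology.eventually_ne_cobounded x
      filter_upwards [hne] with z hz
      exact analyticAt_const.add (analyticAt_const.mul
        ((analyticAt_id.sub analyticAt_const).fun_zpow (sub_ne_zero.2 hz)))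
    · fun_prop
  · push Not at hP
    have han : ∀ z, AnalyticAt ℂ φ z := fun z => hφ.analyticAt_of_not_neg (hP z).not_gt
    exact meromorphicAt_comp_inv_of_commutes_of_entire (fun z => (han z).differentiableAt) hq
      fun z => (h z).2 (hP z).not_gt

end HighDegree

/-! ### Affine maps whose multiplier is not a root of unity. -/

section Affine

/-- Comparing leading Laurent coefficients at order `n` gives `a ^ n = a`, so `n = 1`. -/
theorem MeromorphicAt.order_eq_one_of_comp_mul {F : ℂ → ℂ} {a : ℂ} (hF : MeromorphicAt F 0)
    (ha : a ≠ 0) (hroot : ∀ N : ℕ, 0 < N → a ^ N ≠ 1)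
    (h : ∀ᶠ w in 𝓝[≠] 0, F (a * w) = a * F w) (htop : meromorphicOrderAt F 0 ≠ ⊤) :
    meromorphicOrderAt F 0 = 1 := by
  obtain ⟨n, hn⟩ := WithTop.ne_top_iff_exists.1 htop
  obtain ⟨u, hu, hu0, hev⟩ := (meromorphicOrderAt_eq_int_iff hF).1 hn.symm
  have htend0 : Tendsto (fun w => a * w) (𝓝 (0 : ℂ)) (𝓝 0) := by
    simpa using (continuous_const_mul a).tendsto 0
  have htend : Tendsto (fun w => a * w) (𝓝[≠] (0 : ℂ)) (𝓝[≠] 0) := by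
    refine tendsto_nhdsWithin_iff.2 ⟨htend0.mono_left nhdsWithin_le_nhds, ?_⟩
    filter_upwards [self_mem_nhdsWithin] with w hw
    exact mul_ne_zero ha hw
  have hpunct : ∀ᶠ w in 𝓝[≠] 0, a ^ n * u (a * w) = a * u w := by
    filter_upwards [hev, htend.eventually hev, h, self_mem_nhdsWithin] with w h1 h2 h3 hw
    have hw' : w ^ n ≠ 0 := zpow_ne_zero _ hw
    rw [h3, h1, sub_zero, sub_zero, smul_eq_mul, smul_eq_mul, mul_zpow] at h2
    refine mul_left_cancel₀ hw' ?_
    linear_combination -h2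
  have hc := hu.continuousAt.tendsto
  have hlim := tendsto_nhds_unique_of_eventuallyEq
    (((hc.comp htend0).mono_left nhdsWithin_le_nhds).const_mul (a ^ n))
    ((hc.mono_left nhdsWithin_le_nhds).const_mul a) hpunct
  have han : a ^ n = a := mul_right_cancel₀ hu0 hlim
  have h1 : a ^ (n - 1) = 1 := by rw [zpow_sub₀ ha, zpow_one, han, div_self ha]
  have hn1 : n - 1 = 0 := by
    by_contra hne
    refine hroot (n - 1).natAbs (Int.natAbs_pos.2 hne) ?_
    rcases Int.natAbs_eq (n - 1) with h2 | h2
    · rw [h2, zpow_natCast] at h1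
      exact h1
    · rw [h2, zpow_neg, zpow_natCast, inv_eq_one] at h1
      exact h1
  rw [← hn, show n = 1 by omega]
  rfl

theorem MeromorphicAt.exists_eventuallyEq_mul_of_comp_mul {F : ℂ → ℂ} {a : ℂ}
    (hF : MeromorphicAt F 0) (ha : a ≠ 0) (hroot : ∀ N : ℕ, 0 < N → a ^ N ≠ 1)
    (h : ∀ᶠ w in 𝓝[≠] 0, F (a * w) = a * F w) : ∃ c : ℂ, F =ᶠ[𝓝[≠] 0] fun w => c * w := by
  by_cases htop : meromorphicOrderAt F 0 = ⊤
  · refine ⟨0, ?_⟩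
    filter_upwards [meromorphicOrderAt_eq_top_iff.1 htop] with w hw
    simpa using hw
  obtain ⟨u, hu, hu0, hev⟩ := (meromorphicOrderAt_eq_int_iff (n := 1) hF).1
    (hF.order_eq_one_of_comp_mul ha hroot h htop)
  -- Removing the linear term preserves the equation, so a nonzero remainder would again have order
  -- 1; but its linear coefficient is 0.
  have hG : MeromorphicAt (fun w => F w - u 0 * w) 0 := by fun_prop
  refine ⟨u 0, ?_⟩
  by_cases hGtop : meromorphicOrderAt (fun w => F w - u 0 * w) 0 = ⊤
  · filter_upwards [meromorphicOrderAt_eq_top_iff.1 hGtop] with w hw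
    exact sub_eq_zero.1 hw
  obtain ⟨v, hv, hv0, hev'⟩ := (meromorphicOrderAt_eq_int_iff (n := 1) hG).1
    (hG.order_eq_one_of_comp_mul ha hroot (by
      filter_upwards [h] with w hw
      rw [hw]; ring) hGtop)
  have heq : ∀ᶠ w in 𝓝[≠] 0, u w - u 0 = v w := by
    filter_upwards [hev, hev', self_mem_nhdsWithin] with w h1 h2 hw
    rw [h1, zpow_one, sub_zero, smul_eq_mul, smul_eq_mul] at h2
    refine mul_left_cancel₀ hw ?_
    linear_combination h2
  have hlim := tendsto_nhds_unique_of_eventuallyEq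
    ((hu.continuousAt.tendsto.mono_left nhdsWithin_le_nhds).sub_const (u 0))
    (hv.continuousAt.tendsto.mono_left nhdsWithin_le_nhds) heq
  exact absurd hlim.symm (by simpa using hv0)

theorem MeromorphicNFOn.meromorphicAt_comp_inv_of_affine {φ : ℂ → ℂ}
    (hφ : MeromorphicNFOn φ Set.univ) {a b : ℂ} (ha : a ≠ 0)
    (hroot : ∀ N : ℕ, 0 < N → a ^ N ≠ 1)
    (h : ∀ z, ¬ meromorphicOrderAt φ z < 0 → φ (a * z + b) = a * φ z + b) :
    MeromorphicAt (fun w => φ w⁻¹) 0 := by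
  have ha1 : 1 - a ≠ 0 := fun h1 => hroot 1 one_pos (by rw [pow_one]; linear_combination -h1)
  set z₀ := b / (1 - a)
  have hz₀ : b = z₀ * (1 - a) := by simp only [z₀]; field_simp
  have hmer : MeromorphicAt φ (0 + z₀) := by
    rw [zero_add]; exact hφ.meromorphicOn z₀ (Set.mem_univ z₀)
  have hF : MeromorphicAt (fun w => φ (w + z₀) - z₀) 0 :=
    (hmer.comp_analyticAt (g := fun w => w + z₀) (by fun_prop)).sub (MeromorphicAt.const _ _)
  have htend : Tendsto (fun w : ℂ => w + z₀) (𝓝[≠] 0) (𝓝[≠] (0 + z₀)) := by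
    refine tendsto_nhdsWithin_iff.2
      ⟨((continuous_add_const z₀).tendsto 0).mono_left nhdsWithin_le_nhds, ?_⟩
    filter_upwards [self_mem_nhdsWithin] with w hw
    simpa using hw
  obtain ⟨c, hc⟩ := hF.exists_eventuallyEq_mul_of_comp_mul ha hroot (by
    filter_upwards [htend.eventually hmer.eventually_not_meromorphicOrderAt_neg] with w hw
    have := h _ hw
    rw [show a * (w + z₀) + b = a * w + z₀ by rw [hz₀]; ring] at this
    rw [this]
    linear_combination hz₀)
  refine hφ.meromorphicAt_comp_inv_of_eventuallyEq (x := z₀) (R := fun z => c * (z - z₀) + z₀)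
    (fun z _ => by fun_prop) (Eventually.of_forall fun z => by fun_prop) (by fun_prop) ?_
  have htend' : Tendsto (fun z : ℂ => z - z₀) (𝓝[≠] z₀) (𝓝[≠] 0) := by
    refine tendsto_nhdsWithin_iff.2 ⟨?_, ?_⟩
    · simpa using ((continuous_sub_right z₀).tendsto z₀).mono_left nhdsWithin_le_nhds
    · filter_upwards [self_mem_nhdsWithin] with z hz
      exact sub_ne_zero.2 hz
  filter_upwards [htend'.eventually hc] with z hz
  rw [sub_add_cancel] at hz
  linear_combination hz

end Affine

/-! ### Construction of transcendental commuting functions. -/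

section Existence

open Asymptotics Bornology

theorem exists_isBigO_pow_of_meromorphicAt_comp_inv {φ : ℂ → ℂ}
    (h : MeromorphicAt (fun w => φ w⁻¹) 0) : ∃ k : ℕ, φ =O[cobounded ℂ] fun z => z ^ k := by
  obtain ⟨k, hk⟩ := h
  refine ⟨k, ?_⟩
  have h1 : (fun w : ℂ => (w - 0) ^ k • φ w⁻¹) =O[𝓝 0] fun _ => (1 : ℂ) :=
    hk.continuousAt.tendsto.isBigO_one ℂ
  have h2 := (h1.comp_tendsto (tendsto_inv₀_cobounded (α := ℂ))).mul
    (isBigO_refl (fun z : ℂ => z ^ k) (cobounded ℂ))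
  have hne : ∀ᶠ z in cobounded ℂ, z ≠ 0 := eventually_ne_cobounded 0
  refine h2.congr' ?_ (by simp [EventuallyEq])
  filter_upwards [hne] with z hz
  simp only [Function.comp_apply, sub_zero, inv_inv, smul_eq_mul, inv_pow]
  field_simp

/-- A pole or removable singularity at infinity allows only polynomial growth along a ray.
Subtracting `A + t * B` isolates the exponential term of the examples. -/
theorem not_meromorphicAt_comp_inv_of_exp_le {φ : ℂ → ℂ} {z₀ v A B : ℂ} (hv : v ≠ 0)
    (h : ∀ t : ℝ, 1 ≤ t → Real.exp t ≤ ‖φ (z₀ + t * v) - A - t * B‖) :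
    ¬ MeromorphicAt (fun w => φ w⁻¹) 0 := by
  intro hmer
  obtain ⟨k, hk⟩ := exists_isBigO_pow_of_meromorphicAt_comp_inv hmer
  have hlin : ∀ x y : ℂ, (fun t : ℝ => x + t * y) =O[atTop] fun t : ℝ => t := by
    intro x y
    refine IsBigO.add ?_ ?_
    · exact (isLittleO_const_id_atTop x).isBigO
    · exact IsBigO.of_bound ‖y‖ (Eventually.of_forall fun t => by
        rw [norm_mul, Complex.norm_real, mul_comm])
  have htend : Tendsto (fun t : ℝ => z₀ + t * v) atTop (cobounded ℂ) := by
    refine tendsto_norm_atTop_iff_cobounded.1 ?_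
    have h1 : Tendsto (fun t : ℝ => t * ‖v‖ - ‖z₀‖) atTop atTop :=
      tendsto_atTop_add_const_right _ _ (tendsto_id.atTop_mul_const (norm_pos_iff.2 hv))
    refine tendsto_atTop_mono' _ ?_ h1
    filter_upwards [eventually_ge_atTop 0] with t ht
    have h2 := norm_sub_norm_le ((t : ℂ) * v) (-z₀)
    rw [norm_neg, norm_mul, Complex.norm_real, Real.norm_of_nonneg ht, sub_neg_eq_add,
      add_comm ((t : ℂ) * v)] at h2
    exact h2
  have hpow : (fun t : ℝ => t) =O[atTop] fun t : ℝ => t ^ (k + 1) :=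
    IsBigO.of_bound 1 (by
      filter_upwards [eventually_ge_atTop 1] with t ht
      rw [one_mul, norm_pow]
      exact le_self_pow₀ (by rwa [Real.norm_of_nonneg (by linarith)]) (by omega))
  have hpow' : (fun t : ℝ => t ^ k) =O[atTop] fun t : ℝ => t ^ (k + 1) :=
    IsBigO.of_bound 1 (by
      filter_upwards [eventually_ge_atTop 1] with t ht
      rw [one_mul, norm_pow, norm_pow]
      exact pow_le_pow_right₀ (by rwa [Real.norm_of_nonneg (by linarith)]) (by omega))
  have hbig : (fun t : ℝ => φ (z₀ + t * v) - (A + t * B)) =O[atTop] fun t : ℝ => t ^ (k + 1) :=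
    ((((hk.comp_tendsto htend).trans ((hlin z₀ v).pow k)).trans hpow').sub
      ((hlin A B).trans hpow))
  have hexp : Real.exp =O[atTop] fun t : ℝ => t ^ (k + 1) := by
    refine IsBigO.trans (IsBigO.of_bound 1 ?_) hbig
    filter_upwards [eventually_ge_atTop 1] with t ht
    rw [Real.norm_of_nonneg (Real.exp_pos t).le, one_mul, ← sub_sub]
    exact h t ht
  exact (Real.isLittleO_pow_exp_atTop (n := k + 1)).not_isBigO
    ((eventually_ne_atTop 0).mono fun t ht => pow_ne_zero _ ht).frequently hexp

theorem permutes_merMap_of_entire {φ ψ : ℂ → ℂ} (hφ : ∀ z, AnalyticAt ℂ φ z)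
    (h : ∀ z, φ (ψ z) = ψ (φ z)) :
    Permutes (merMap φ) (OnePoint.map ψ : OnePoint ℂ →. OnePoint ℂ) := by
  have hval : ∀ z : ℂ, merMap φ z = Part.some ((φ z : ℂ) : OnePoint ℂ) := fun z => by
    rw [merMap_coe, if_neg (not_lt.2 (hφ z).meromorphicOrderAt_nonneg)]
  unfold Permutes
  funext w
  rw [PFun.comp_apply, PFun.comp_apply, PFun.coe_val]
  refine (Part.bind_some _ (merMap φ)).trans ?_
  refine Eq.trans ?_ (Part.bind_some_eq_map (OnePoint.map ψ) (merMap φ w)).symm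
  induction w using OnePoint.rec with
  | infty => rw [OnePoint.map_infty, merMap_infty, Part.map_none]
  | coe z => rw [OnePoint.map_some, hval, hval, Part.map_some, OnePoint.map_some, h]

theorem exists_entire_commutes_affine {a c : ℂ} {N : ℕ} (hN : 0 < N) (ha : a ^ N = 1) :
    ∃ φ : ℂ → ℂ, (∀ z, AnalyticAt ℂ φ z) ∧ ¬ MeromorphicAt (fun w => φ w⁻¹) 0 ∧
      ∀ z, φ (z * a + c) = φ z * a + c := by
  by_cases hac : a = 1 ∧ c ≠ 0
  · obtain ⟨rfl, hc⟩ := hac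
    have hpi := Complex.two_pi_I_ne_zero
    refine ⟨fun z => z + Complex.exp (2 * Real.pi * Complex.I * z / c), fun z => by fun_prop,
      ?_, fun z => ?_⟩
    · refine not_meromorphicAt_comp_inv_of_exp_le
        (φ := fun z => z + Complex.exp (2 * Real.pi * Complex.I * z / c)) (z₀ := 0) (A := 0)
        -- Along this direction the exponent is exactly `t`.
        (v := c / (2 * Real.pi * Complex.I)) (B := c / (2 * Real.pi * Complex.I))
        (div_ne_zero hc hpi) fun t ht => ?_
      have : 2 * Real.pi * Complex.I * (0 + t * (c / (2 * Real.pi * Complex.I))) / c = (t : ℂ) := by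
        field_simp
        simp
      rw [this, ← Complex.ofReal_exp]
      simp
    · have : 2 * Real.pi * Complex.I * (z * 1 + c) / c =
          2 * Real.pi * Complex.I * z / c + 2 * Real.pi * Complex.I := by
        field_simp
      beta_reduce
      rw [this, Complex.exp_add, Complex.exp_two_pi_mul_I]
      ring
  -- Outside the case of a nontrivial translation the affine map has a fixed point, and `(z - z₀) ^
  -- N` is invariant because `a ^ N = 1`.
  · obtain ⟨z₀, hz₀⟩ : ∃ z₀, z₀ * a + c = z₀ := by
      by_cases h1 : a = 1
      · exact ⟨0, by simpa [h1] using hac⟩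
      · have : 1 - a ≠ 0 := sub_ne_zero.2 (Ne.symm h1)
        exact ⟨c / (1 - a), by field_simp; ring⟩
    refine ⟨fun z => z₀ + (z - z₀) * Complex.exp ((z - z₀) ^ N), fun z => by fun_prop,
      ?_, fun z => ?_⟩
    · refine not_meromorphicAt_comp_inv_of_exp_le
        (φ := fun z => z₀ + (z - z₀) * Complex.exp ((z - z₀) ^ N)) (z₀ := z₀) (A := z₀) (v := 1) (B := 0)
        one_ne_zero fun t ht => ?_
      have : z₀ + (z₀ + t * 1 - z₀) * Complex.exp ((z₀ + t * 1 - z₀) ^ N) - z₀ - t * 0 =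
          ((t * Real.exp (t ^ N) : ℝ) : ℂ) := by
        push_cast
        ring_nf
      rw [this, Complex.norm_real, Real.norm_of_nonneg (by positivity)]
      calc Real.exp t ≤ Real.exp (t ^ N) := Real.exp_le_exp.2 (le_self_pow₀ ht hN.ne')
        _ ≤ t * Real.exp (t ^ N) := le_mul_of_one_le_left (Real.exp_pos _).le ht
    · have : z * a + c - z₀ = a * (z - z₀) := by linear_combination hz₀
      beta_reduce
      rw [this, mul_pow, ha, one_mul]
      linear_combination -hz₀

end Existence

theorem Complex.exp_two_pi_mul_div_pow_natAbs (m : ℤ) {n : ℤ} (hn : n ≠ 0) :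
    Complex.exp (2 * (Real.pi : ℂ) * Complex.I * (m : ℂ) / (n : ℂ)) ^ n.natAbs = 1 := by
  have hn' : (n : ℂ) ≠ 0 := Int.cast_ne_zero.2 hn
  have h1 : Complex.exp (2 * (Real.pi : ℂ) * Complex.I * (m : ℂ) / (n : ℂ)) ^ n = 1 := by
    rw [← Complex.exp_int_mul, Complex.exp_eq_one_iff]
    exact ⟨m, by field_simp⟩
  rcases Int.natAbs_eq n with h2 | h2
  · rw [h2, zpow_natCast] at h1
    rwa [← h2] at h1
  · rw [h2, zpow_neg, zpow_natCast, inv_eq_one] at h1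
    rwa [← h2] at h1

theorem Complex.exists_eq_exp_of_pow_eq_one {a : ℂ} {N : ℕ} (hN : 0 < N) (ha : a ^ N = 1) :
    ∃ m : ℤ, a = Complex.exp (2 * (Real.pi : ℂ) * Complex.I * (m : ℂ) / ((N : ℤ) : ℂ)) := by
  have ha0 : a ≠ 0 := by rintro rfl; simp [hN.ne'] at ha
  have hN' : (N : ℂ) ≠ 0 := Nat.cast_ne_zero.2 hN.ne'
  rw [← Complex.exp_log ha0, ← Complex.exp_nat_mul, Complex.exp_eq_one_iff] at ha
  obtain ⟨m, hm⟩ := ha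
  refine ⟨m, ?_⟩
  rw [← Complex.exp_log ha0]
  congr 1
  push_cast
  rw [eq_div_iff hN']
  linear_combination hm

theorem theorem1p1 (g : OnePoint ℂ → OnePoint ℂ) (hg : IsRationalMap g)
    (hnc : ¬ ∃ a : OnePoint ℂ, ∀ w, g w = a) :
    (∃ f : OnePoint ℂ →. OnePoint ℂ, IsTranscendentalMeromorphic f ∧
        Permutes f (g : OnePoint ℂ →. OnePoint ℂ)) ↔
      ∃ (m n : ℤ) (c : ℂ), n ≠ 0 ∧
        g = OnePoint.map (fun z : ℂ =>
          z * Complex.exp (2 * (Real.pi : ℂ) * Complex.I * (m : ℂ) / (n : ℂ)) + c) := by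
  constructor
  · rintro ⟨f, ⟨φ, hφ, hess, rfl⟩, hperm⟩
    obtain ⟨r, rfl⟩ := hg
    have hcomm := commutesWithPoly_of_permutes hperm
    have hpos := natDegree_pos_of_permutes hperm
    have hdeg : r.num.natDegree = 1 := by
      by_contra hne
      exact hess (hcomm.meromorphicAt_comp_inv hφ (by omega))
    obtain ⟨a, ha, b, hab⟩ := natDegree_eq_one.1 hdeg
    have heval : ∀ z, r.num.eval z = a * z + b := fun z => by simp [← hab]
    obtain ⟨N, hN, haN⟩ : ∃ N : ℕ, 0 < N ∧ a ^ N = 1 := by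
      by_contra! hroot
      refine hess (hφ.meromorphicAt_comp_inv_of_affine ha hroot (b := b) fun z hz => ?_)
      rw [← heval, ← heval]
      exact (hcomm z).2 hz
    obtain ⟨m, hm⟩ := Complex.exists_eq_exp_of_pow_eq_one hN haN
    refine ⟨m, N, b, by exact_mod_cast hN.ne', ?_⟩
    funext w
    induction w using OnePoint.rec with
    | infty => rw [ratMap_infty_eq_infty_of_permutes hperm, OnePoint.map_infty]
    | coe z =>
      rw [ratMap_coe_of_denom_eq_one (denom_eq_one_of_permutes hperm), OnePoint.map_some, heval,
        ← hm, mul_comm a z]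
  · rintro ⟨m, n, c, hn, rfl⟩
    obtain ⟨φ, hφ, hess, hcomm⟩ := exists_entire_commutes_affine (c := c)
      (Int.natAbs_pos.2 hn) (Complex.exp_two_pi_mul_div_pow_natAbs m hn)
    exact ⟨merMap φ, ⟨φ, AnalyticOnNhd.meromorphicNFOn fun z _ => hφ z, hess, rfl⟩,
      permutes_merMap_of_entire hφ hcomm⟩
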